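/- **Setting.** Let $G=(V,E)$ be a finite, connected, simple planar graph with all degrees at least two, with a fixed regular isoradial embedding: edges are straight, non-crossing segments in $\mathbb C$, every inner face is inscribed in a circle of radius $1$, and the circumcenters are in the closures of the inner faces. For $e\in E$ let $\theta_e=\arccos(|e|/2)$, the half-angle, at an end of $e$, of the rhombus of side-length $1$ with diagonal $e$ (for $e=xy$ on the boundary of an inner face with circumcenter $c$, it is the angle between $xy$ and $xc$). *Extended double graph.* List the boundary edges of $G$ as $e_1,\dots,e_n$ in the clockwise order in which they are met along the boundary of the outer face (an edge with the outer face on both sides is listed twice), with cyclic indices, and let $x_j$ be the end of $e_j$ at which the traversal passes to $e_{j+1}$. The extended dual $G^*_{\mathrm{ext}}$ is obtained from the dual graph by splitting the outer vertex into $u_1,\dots,u_n$, where $u_j$ is the end of the dual edge of $e_j$, and by adding boundary edges $u_ju_{j+1}$. Its dual $G_{\mathrm{ext}}$, with edge set $E_{\mathrm{ext}}$, consists of $G$, an outer vertex $r$, and the edges $x_jr$ dual to $u_ju_{j+1}$. The extended double graph $G^D_{\mathrm{ext}}$ is the bipartite multigraph whose black vertices are the vertices of $G$ and those of $G^*_{\mathrm{ext}}$,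 whose white vertices are the crossings of dual pairs of edges (a vertex $w_e$ for each $e\in E$ and a boundary vertex $w_j$ for each $j$), and whose edges are the half-edges, those ending at $r$ being removed. Let $\alpha_j\in(0,2\pi]$ be the angle of the corner of the outer face at $x_j$ between $e_j$ and $e_{j+1}$, and $\theta^\partial_j=\tfrac12(\alpha_j-\theta_{e_j}-\theta_{e_{j+1}})\in\mathbb R$. *Weights.* Define weights on the edges of $G^D_{\mathrm{ext}}$ by - $\rho^*=\tau=\sin\theta_e$ on both halves of $e\in E$, and $\rho^*=\tau=i\cos\theta_e$ on both halves of the dual of $e$; - $\rho^*=1$ on $w_ju_j$ and on $w_ju_{j+1}$, and $\rho^*=e^{-i\theta^\partial_j}-1$ on $w_jx_j$; - $\tau=ie^{-i\theta^\partial_j/2}$ on $w_ju_j$, $\tau=ie^{i\theta^\partial_j/2}$ on $w_ju_{j+1}$, and $\tau=2\sin(\theta^\partial_j/2)$ on $w_jx_j$. *Constrained trees.* Fix a root $s\in\{u_1,\dots,u_n\}$. An oriented spanning tree rooted at $s$ is a set of oriented edges of $G^D_{\mathrm{ext}}$ without cycle such that every vertex other than $s$ has exactly one outgoing edge. Let $\mathcal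 T^s_{(1,2)}$ be the set of those trees $T$ whose unoriented version satisfies: 1. at $w_e$, $e\in E$: for each of the two orientations $(x,y)$ of $e$, exactly one of the following two half-edges is present: the half of $e$ at $y$, and the half of the dual edge on the left of $(x,y)$; 2. at $w_j$: $w_ju_j$ is present, together with exactly one of $w_ju_{j+1}$ and $w_jx_j$. Let $G^D_{\mathrm{ext}}(s)$ be $G^D_{\mathrm{ext}}$ with $s$ and its incident edges removed. For a perfect matching $M$ of $G^D_{\mathrm{ext}}(s)$, let $\mathcal T^s_{(1,2),M}$ be the set of trees in $\mathcal T^s_{(1,2)}$ whose edges exiting from black vertices are exactly the edges of $M$. The weight $\rho^*(T)$ of a tree is the product of the weights of its edges. Let $Z^s_{\mathrm{OST},(1,2)}(G^D_{\mathrm{ext}},\rho^*)=\sum_{T\in\mathcal T^s_{(1,2)}}\rho^*(T)$ and $Z_{\mathrm{dimer}}(G^D_{\mathrm{ext}}(s),\tau)=\sum_M\prod_{h\in M}\tau_h$, the sum being over perfect matchings of $G^D_{\mathrm{ext}}(s)$. **Proposition.** 1. For every perfect matching $M$ of $G^D_{\mathrm{ext}}(s)$, $$\sum_{T\in\mathcal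 T^s_{(1,2),M}}\rho^*(T)=\Bigl(\prod_{e\in E}ie^{-i\theta_e}\Bigr)\Bigl(\prod_{j=1}^n -ie^{-i\theta^\partial_j/2}\Bigr)\prod_{h\in M}\tau_h .$$ 2. $$Z^s_{\mathrm{OST},(1,2)}(G^D_{\mathrm{ext}},\rho^*)=\Bigl(\prod_{e\in E}ie^{-i\theta_e}\Bigr)\Bigl(\prod_{j=1}^n -ie^{-i\theta^\partial_j/2}\Bigr)Z_{\mathrm{dimer}}(G^D_{\mathrm{ext}}(s),\tau).$$ -/

import Mathlib

noncomputable section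

open scoped Classical

/-! ## Bipartite multigraphs, rooted oriented spanning trees, perfect matchings -/

/-- A bipartite multigraph with black vertices `B`, white vertices `W`, and edges `E`
(parallel edges are allowed); every edge joins a black vertex to a white one. -/
structure BipMultigraph (B W E : Type*) where
  black : E → B
  white : E → W

namespace BipMultigraph

variable {B W E : Type*} (Γ : BipMultigraph B W E)

/-- Oriented edges: `(h, true)` is `h` oriented from its black to its white end,
`(h, false)` is `h` oriented from its white to its black end. -/
def src (a : E × Bool) : B ⊕ W :=
  if a.2 = true then Sum.inl (Γ.black a.1) else Sum.inr (Γ.white a.1)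

/-- The end vertex of an oriented edge. -/
def tgt (a : E × Bool) : B ⊕ W :=
  if a.2 = true then Sum.inr (Γ.white a.1) else Sum.inl (Γ.black a.1)

/-- `T` has an oriented edge from `u` to `v`. -/
def Step (T : Finset (E × Bool)) (u v : B ⊕ W) : Prop :=
  ∃ a ∈ T, Γ.src a = u ∧ Γ.tgt a = v

/-- `T` is an oriented spanning tree rooted at `r`: every vertex other than `r` has exactly one
outgoing edge in `T`, and `T` has no cycle (no vertex is reachable from itself by a nonempty
directed path; in particular the root has no outgoing edge, and no edge is used in both
directions). -/
def IsOST (r : B ⊕ W) (T : Finset (E × Bool)) : Prop :=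
  (∀ v, v ≠ r → ∃! a, a ∈ T ∧ Γ.src a = v) ∧ ∀ v, ¬ Relation.TransGen (Γ.Step T) v v

/-- `M` is a perfect matching of the graph `Γ` from which the black vertex `s` and all its incident
edges have been removed. -/
def IsPerfectMatchingMinus (s : B) (M : Finset E) : Prop :=
  (∀ h ∈ M, Γ.black h ≠ s) ∧
  (∀ b, b ≠ s → ∃! h, h ∈ M ∧ Γ.black h = b) ∧
  (∀ w, ∃! h, h ∈ M ∧ Γ.white h = w)

/-- The dimer partition function of `Γ` minus the black vertex `s`, with edge weights `τ`. -/
def dimerZMinus [Fintype E] (s : B) (τ : E → ℂ) : ℂ :=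
  ∑ M ∈ (Finset.univ : Finset (Finset E)).filter (fun M => Γ.IsPerfectMatchingMinus s M),
    ∏ h ∈ M, τ h

end BipMultigraph

/-- The edge `h` belongs to the unoriented version of `T`. -/
def EdgeUsed {E : Type*} (T : Finset (E × Bool)) (h : E) : Prop :=
  (h, true) ∈ T ∨ (h, false) ∈ T

/-- The perfect matching `M` consists of the edges of `T` that exit from black vertices. -/
def CompatibleWith {E : Type*} (T : Finset (E × Bool)) (M : Finset E) : Prop :=
  ∀ h, h ∈ M ↔ (h, true) ∈ T

/-! ## Planar maps -/

/-- Reversal of darts, as a permutation. -/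
def dartRev {V : Type*} (G : SimpleGraph V) : Equiv.Perm G.Dart :=
  Function.Involutive.toPerm SimpleGraph.Dart.symm SimpleGraph.Dart.symm_involutive

/-- If `rot` sends a dart to the next dart counterclockwise around its initial vertex, then
`faceNext` sends a dart to the next dart along the boundary of the face on its left. -/
def faceNext {V : Type*} {G : SimpleGraph V} (rot : Equiv.Perm G.Dart) : Equiv.Perm G.Dart :=
  rot⁻¹ * dartRev G

/-- The faces of a rotation system: the orbits of `faceNext`. -/
abbrev MapFace {V : Type*} {G : SimpleGraph V} (rot : Equiv.Perm G.Dart) : Type _ :=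
  Quotient (Equiv.Perm.SameCycle.setoid (faceNext rot))

/-- The combinatorial datum of a planar embedding of a graph `G` (which is going to be connected):
the counterclockwise cyclic order of the darts around every vertex, of genus `0`, and the choice of
the outer face. -/
structure PlanarMap {V : Type*} (G : SimpleGraph V) where
  rot : Equiv.Perm G.Dart
  /-- the orbits of `rot` are the sets of darts with a given initial vertex -/
  rot_sameCycle : ∀ d d' : G.Dart, rot.SameCycle d d' ↔ d.fst = d'.fst
  /-- the map lies on the sphere -/
  genus_zero : Nat.card V + Nat.card (MapFace rot) = Nat.card G.edgeSet + 2
  outer : MapFace rot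

namespace PlanarMap

variable {V : Type*} {G : SimpleGraph V} (P : PlanarMap G)

/-- The face on the left of a dart. -/
def leftFace (d : G.Dart) : MapFace P.rot := Quotient.mk _ d

/-- The inner faces. -/
abbrev InnerFace : Type _ := {f : MapFace P.rot // f ≠ P.outer}

/-- The boundary edges of `G`, as darts with the outer face on their left; these darts traverse the
boundary of the outer face clockwise (as seen from the bounded side). -/
abbrev BdDart : Type _ := {d : G.Dart // P.leftFace d = P.outer}

lemma leftFace_faceNext (d : G.Dart) : P.leftFace (faceNext P.rot d) = P.leftFace d :=
  Quotient.sound (Equiv.Perm.SameCycle.symm ⟨1, by simp⟩)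

lemma faceNext_fst (d : G.Dart) : (faceNext P.rot d).fst = d.snd :=
  (P.rot_sameCycle (faceNext P.rot d) d.symm).1 ⟨1, by simp [faceNext, dartRev]⟩

instance [Finite G.Dart] : Fintype P.BdDart := Fintype.ofFinite _

/-- The next boundary edge, clockwise. -/
def bdNext (b : P.BdDart) : P.BdDart :=
  ⟨faceNext P.rot b.1, (P.leftFace_faceNext b.1).trans b.2⟩

/-! ### The extended double graph

The outer dual vertex is split into one vertex `bdry b` per boundary edge `b`, and `bdry b` is
joined to `bdry (bdNext b)`; this boundary edge of the extended dual crosses the edge `x r` of the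
extended graph, where `x = b.snd` is the vertex common to `b` and `bdNext b` and `r` is the outer
vertex of the extended graph.  White vertices are the crossings of primal and dual edges, edges are
half-edges, and those that end at `r` are removed. -/

/-- Black vertices: vertices of `G` (bullets), and vertices of the extended dual (lozenges), i.e.
inner faces of `G` and the vertices coming from the splitting of the outer dual vertex. -/
inductive DoubleBlack
  | primal (v : V)
  | inner (f : P.InnerFace)
  | bdry (b : P.BdDart)

/-- White vertices: the crossings of an edge of `G` with its dual edge, and the crossings, indexed
by `b`, of the boundary edge `bdry b, bdry (bdNext b)` of the extended dual with its primal edge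
`b.snd, r`. -/
inductive DoubleWhite
  | edge (e : G.edgeSet)
  | bdry (b : P.BdDart)

/-- Edges of the extended double graph. -/
inductive DoubleEdge
  /-- half of the primal edge `d.edge`, at the initial vertex of `d` -/
  | primalHalf (d : G.Dart)
  /-- half of the dual edge of `d.edge`, on the left of `d` -/
  | dualHalf (d : G.Dart)
  /-- half of the edge `b.snd, r` of the extended graph, at `b.snd` -/
  | bdPrimal (b : P.BdDart)
  /-- half of the edge `bdry b, bdry (bdNext b)`, at `bdry b` -/
  | bdFirst (b : P.BdDart)
  /-- half of the edge `bdry b, bdry (bdNext b)`, at `bdry (bdNext b)` -/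
  | bdSecond (b : P.BdDart)

instance [Finite G.Dart] : Finite P.DoubleEdge := by
  refine Finite.of_surjective
    (fun x : (G.Dart ⊕ G.Dart) ⊕ (P.BdDart ⊕ P.BdDart ⊕ P.BdDart) =>
      match x with
      | .inl (.inl d) => DoubleEdge.primalHalf d
      | .inl (.inr d) => DoubleEdge.dualHalf d
      | .inr (.inl b) => DoubleEdge.bdPrimal b
      | .inr (.inr (.inl b)) => DoubleEdge.bdFirst b
      | .inr (.inr (.inr b)) => DoubleEdge.bdSecond b) ?_
  rintro (d | d | b | b | b)
  exacts [⟨.inl (.inl d), rfl⟩, ⟨.inl (.inr d), rfl⟩, ⟨.inr (.inl b), rfl⟩,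
    ⟨.inr (.inr (.inl b)), rfl⟩, ⟨.inr (.inr (.inr b)), rfl⟩]

instance [Finite G.Dart] : Fintype P.DoubleEdge := Fintype.ofFinite _

/-- The vertex of the extended dual on the left of a dart. -/
def leftDual (d : G.Dart) : P.DoubleBlack :=
  if h : P.leftFace d = P.outer then .bdry ⟨d, h⟩ else .inner ⟨P.leftFace d, h⟩

/-- The extended double graph. -/
def extDouble : BipMultigraph P.DoubleBlack P.DoubleWhite P.DoubleEdge where
  black
    | .primalHalf d => .primal d.fst
    | .dualHalf d => P.leftDual d
    | .bdPrimal b => .primal b.1.snd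
    | .bdFirst b => .bdry b
    | .bdSecond b => .bdry (P.bdNext b)
  white
    | .primalHalf d => .edge ⟨d.edge, d.edge_mem⟩
    | .dualHalf d => .edge ⟨d.edge, d.edge_mem⟩
    | .bdPrimal b => .bdry b
    | .bdFirst b => .bdry b
    | .bdSecond b => .bdry b

/-- The local constraints at white vertices.
1. At the crossing of an edge `e` of `G` with its dual, for either orientation `d` of `e`, exactly
one of the following two half-edges is present: the dual half-edge on the left of `d`, and the
primal half-edge at the final vertex of `d`.  (These are the two edges dual to the edges that exit a
corner of the quadrangle.)  This leaves four configurations; each has two half-edges.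
2. At a boundary white vertex, the half-edge at the first (in clockwise order) of the two
neighbours on the boundary of the extended dual is present, together with exactly one of the two
other half-edges. -/
def LocalRule (T : Finset (P.DoubleEdge × Bool)) : Prop :=
  (∀ d : G.Dart, Xor (EdgeUsed T (.dualHalf d)) (EdgeUsed T (.primalHalf d.symm))) ∧
  (∀ b : P.BdDart, EdgeUsed T (.bdFirst b) ∧
    Xor (EdgeUsed T (.bdSecond b)) (EdgeUsed T (.bdPrimal b)))

/-- The oriented spanning trees of the extended double graph, rooted at the boundary vertex `s` of
the extended dual, that satisfy the local constraints. -/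
def constrainedTrees [Finite G.Dart] (s : P.BdDart) : Finset (Finset (P.DoubleEdge × Bool)) :=
  Finset.univ.filter (fun T => P.extDouble.IsOST (Sum.inl (.bdry s)) T ∧ P.LocalRule T)

/-- The constrained oriented spanning trees compatible with the matching `M`. -/
def constrainedTreesCompatible [Finite G.Dart] (s : P.BdDart) (M : Finset P.DoubleEdge) :
    Finset (Finset (P.DoubleEdge × Bool)) :=
  (P.constrainedTrees s).filter (fun T => CompatibleWith T M)

/-- The weighted sum of a set of oriented edge configurations, for a weight function on unoriented
edges. -/
def treeWeight (𝒯 : Finset (Finset (P.DoubleEdge × Bool))) (w : P.DoubleEdge → ℂ) : ℂ :=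
  ∑ T ∈ 𝒯, ∏ a ∈ T, w a.1

end PlanarMap

/-! ## Isoradial embeddings, half-angles, weights -/

/-- The angle in `(0, 2π]` by which `z` has to be turned counterclockwise to get the direction of
`w`. -/
def ccwAngle (z w : ℂ) : ℝ := toIocMod Real.two_pi_pos 0 (Complex.arg (w / z))

/-- A regular isoradial embedding, with radius `1`, of a graph `G`, which realizes the planar map
`P`. -/
structure IsoradialEmbedding {V : Type*} {G : SimpleGraph V} (P : PlanarMap G) where
  pos : V → ℂ
  pos_injective : Function.Injective pos
  /-- edges, drawn as straight segments, do not cross -/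
  edges_disjoint : ∀ d d' : G.Dart, d.edge ≠ d'.edge →
    Disjoint (openSegment ℝ (pos d.fst) (pos d.snd)) (openSegment ℝ (pos d'.fst) (pos d'.snd))
  /-- no vertex lies in the interior of an edge -/
  pos_notMem : ∀ (v : V) (d : G.Dart), pos v ∉ openSegment ℝ (pos d.fst) (pos d.snd)
  /-- `P.rot d` is the first dart met after `d` when turning counterclockwise around `d.fst` -/
  rot_first : ∀ d d' : G.Dart, d.fst = d'.fst →
    ccwAngle (pos d.snd - pos d.fst) (pos (P.rot d).snd - pos (P.rot d).fst) ≤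
      ccwAngle (pos d.snd - pos d.fst) (pos d'.snd - pos d'.fst)
  /-- the circumcenters of the inner faces -/
  center : P.InnerFace → ℂ
  /-- the inner faces are inscribed in circles of radius `1` -/
  inscribed : ∀ (d : G.Dart) (h : P.leftFace d ≠ P.outer),
    dist (center ⟨P.leftFace d, h⟩) (pos d.fst) = 1
  /-- Circumcenters are in the closure of the faces.  Inner faces are convex polygons (being
  inscribed in circles) traversed counterclockwise, so that the closure of a face is the set of
  points that are on the left of, or in line with, each of its darts. -/
  regular : ∀ (d : G.Dart) (h : P.leftFace d ≠ P.outer),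
    0 ≤ ((starRingEnd ℂ) (pos d.snd - pos d.fst) *
      (center ⟨P.leftFace d, h⟩ - pos d.fst)).im

namespace IsoradialEmbedding

variable {V : Type*} {G : SimpleGraph V} {P : PlanarMap G} (I : IsoradialEmbedding P)

/-- The half-angle `θ_e`: in a rhombus of side-length `1` with diagonal `e`, the angle between `e`
and a side, at a common vertex. -/
def theta (e : Sym2 V) : ℝ :=
  Sym2.lift ⟨fun x y => Real.arccos (dist (I.pos x) (I.pos y) / 2),
    fun x y => by simp only [dist_comm]⟩ e

/-- `θ_e` is the angle at `x` between the edge `e = xy` and the segment from `x` to the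
circumcenter of an inner face on a side of `e`. -/
lemma angle_eq_theta (d : G.Dart) (h : P.leftFace d ≠ P.outer) :
    InnerProductGeometry.angle (I.pos d.snd - I.pos d.fst)
      (I.center ⟨P.leftFace d, h⟩ - I.pos d.fst) = I.theta d.edge := by
  have hx := I.inscribed d h
  have hy : dist (I.center ⟨P.leftFace d, h⟩) (I.pos d.snd) = 1 := by
    have := I.inscribed (faceNext P.rot d) (by rwa [P.leftFace_faceNext])
    simpa only [P.leftFace_faceNext, P.faceNext_fst] using this
  have hxy : I.pos d.snd - I.pos d.fst ≠ 0 :=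
    sub_ne_zero.2 fun e => d.fst_ne_snd (I.pos_injective e).symm
  have hθ : I.theta d.edge = Real.arccos (dist (I.pos d.fst) (I.pos d.snd) / 2) := rfl
  rw [hθ, InnerProductGeometry.angle]
  congr 1
  rw [dist_eq_norm] at hx hy
  rw [hx, dist_comm, dist_eq_norm]
  set c := I.center ⟨P.leftFace d, h⟩
  have e1 : c - I.pos d.snd = (c - I.pos d.fst) - (I.pos d.snd - I.pos d.fst) := by ring
  have e2 := norm_sub_sq_real (c - I.pos d.fst) (I.pos d.snd - I.pos d.fst)
  rw [← e1, hx, hy, real_inner_comm] at e2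
  have hn : ‖I.pos d.snd - I.pos d.fst‖ ≠ 0 := norm_ne_zero_iff.2 hxy
  field_simp
  linarith

/-- The half-angle `θ^∂` assigned to the edge `x r` of the extended graph at the white vertex `b`,
where `x = b.snd`: half the angle between the two half-rhombus sides at `x` that are added along
the boundary.  The edges of `bdNext b` and of `b` bound a corner of the outer face at `x`; the first
side is the direction of `bdNext b` turned counterclockwise by its half-angle, the second one is the
direction of `b.symm` turned clockwise by its half-angle.  The half-rhombi may overlap, in which
case the value is negative. -/
def thetaBd (b : P.BdDart) : ℝ :=
  (ccwAngle (I.pos (P.bdNext b).1.snd - I.pos (P.bdNext b).1.fst) (I.pos b.1.fst - I.pos b.1.snd)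
    - I.theta (P.bdNext b).1.edge - I.theta b.1.edge) / 2

/-- The weights `ρ*` on the edges of the extended double graph. -/
def rhoStar : P.DoubleEdge → ℂ
  | .primalHalf d => (Real.sin (I.theta d.edge) : ℂ)
  | .dualHalf d => Complex.I * (Real.cos (I.theta d.edge) : ℂ)
  | .bdPrimal b => Complex.exp (-Complex.I * (I.thetaBd b : ℂ)) - 1
  | .bdFirst _ => 1
  | .bdSecond _ => 1

/-- The weights `τ` on the edges of the extended double graph. -/
def tau : P.DoubleEdge → ℂ
  | .primalHalf d => (Real.sin (I.theta d.edge) : ℂ)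
  | .dualHalf d => Complex.I * (Real.cos (I.theta d.edge) : ℂ)
  | .bdPrimal b => 2 * (Real.sin (I.thetaBd b / 2) : ℂ)
  | .bdFirst b => Complex.I * Complex.exp (-Complex.I * ((I.thetaBd b / 2 : ℝ) : ℂ))
  | .bdSecond b => Complex.I * Complex.exp (Complex.I * ((I.thetaBd b / 2 : ℝ) : ℂ))

end IsoradialEmbedding

end

/-! Fix a matching `M`. A tree that induces `M` is determined by the exits from the white vertices,
and the local rule makes the exit at `w` one of the `mates` of the half-edge matched to `w`. The
crux is the converse: every such choice of exits is acyclic. Hence the sum over trees factors over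
the white vertices (`treeWeight_compatible`), and the first claim reduces to one identity per
half-edge (`rhoStar_mul_sum_mates`). Each constrained tree induces a perfect matching
(`exists_compatible_matching`), so the second claim is the first one summed over `M`.

Acyclicity comes from `QuadSystem.reaches`, where an Euler-type count replaces a Jordan curve
argument. Let `P` be the set of black vertices that lead to the root `s`, together with the removed
outer vertex `r`, and suppose that `P` misses a vertex. Take as edges the sides of quadrangles with
both ends in `P`, and the diagonal from `M w` to `N w` in each quadrangle with `M w` in `P` and no
such side. This graph is connected on `P`, so `|P| - 1 + #Full ≤ #edges` (`card_add_card_le`).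
Quadrangle by quadrangle, `#edges ≤ #Full + #{w | P (M w)}` (`card_sides_le`). But `M` is injective
and avoids both `r` and `s`, so the last number is at most `|P| - 2`: a contradiction.

The local count could fail only at a quadrangle with exactly two corners in `P`, these being
adjacent. Such quadrangles would all have the same sign, because of the chirality of the allowed
pairs, while their signed count is zero (`same_or_same`). -/

noncomputable section

open scoped Classical

/-! ### Counting in quadrangle systems -/

/-- The quadrangles `pt d, fc (rev d), pt (rev d), fc d` attached to the edges `wt d` of a
connected combinatorial map, with darts `D`; `pt d` is the initial vertex of `d`, `fc d` the face on
its left, and `next d` the following dart along the boundary of this face. -/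
structure QuadSystem (D B W : Type*) where
  rev : D → D
  next : Equiv.Perm D
  pt : D → B
  fc : D → B
  wt : D → W
  rev_rev : ∀ d, rev (rev d) = d
  rev_ne : ∀ d, rev d ≠ d
  pt_next : ∀ d, pt (next d) = pt (rev d)
  fc_next : ∀ d, fc (next d) = fc d
  wt_rev : ∀ d, wt (rev d) = wt d
  eq_or_eq_rev : ∀ d d', wt d' = wt d → d' = d ∨ d' = rev d
  -- Connectedness in the form needed for the kernel computation in `card_add_card_le`, which is
  -- linear algebra over `ℚ`.
  connected : ∀ c : D → ℚ, (∀ d, c (rev d) = c d) → (∀ d, c (next d) = c d) → ∀ d d', c d = c d'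

namespace QuadSystem

variable {D B W : Type*} (S : QuadSystem D B W)

/-- The pairs of corners of the quadrangle of `w` that can be joined: opposite corners, or the
initial vertex of a dart and the face on its left. -/
def Joins (w : W) (b b' : B) : Prop :=
  ∃ d, S.wt d = w ∧ ((b = S.fc d ∧ b' = S.fc (S.rev d)) ∨ (b = S.pt d ∧ b' = S.pt (S.rev d)) ∨
    (b = S.pt d ∧ b' = S.fc d) ∨ (b = S.fc d ∧ b' = S.pt d))

lemma sum_rev [Fintype D] {R : Type*} [AddCommMonoid R] (f : D → R) :
    ∑ d, f (S.rev d) = ∑ d, f d :=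
  Equiv.sum_comp (Function.Involutive.toPerm S.rev S.rev_rev) f

lemma sum_next [Fintype D] {R : Type*} [AddCommMonoid R] (f : D → R) :
    ∑ d, f (S.next d) = ∑ d, f d :=
  Equiv.sum_comp S.next f

lemma sum_wt [Fintype D] [Fintype W] (hsurj : Function.Surjective S.wt) (g : W → ℕ) :
    ∑ d, g (S.wt d) = 2 * ∑ w, g w := by
  rw [← Finset.sum_fiberwise (s := Finset.univ) (g := S.wt), Finset.mul_sum]
  refine Finset.sum_congr rfl fun w _ => ?_
  obtain ⟨d, rfl⟩ := hsurj w
  have : (Finset.univ.filter fun d' => S.wt d' = S.wt d) = {d, S.rev d} := by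
    ext d'
    simp only [Finset.mem_filter, Finset.mem_univ, true_and, Finset.mem_insert,
      Finset.mem_singleton]
    refine ⟨S.eq_or_eq_rev d d', ?_⟩
    rintro (rfl | rfl)
    exacts [rfl, S.wt_rev d]
  rw [this, Finset.sum_pair (S.rev_ne d).symm, S.wt_rev, two_mul]

/-- Edge vectors that come from a function on vertices are orthogonal to those that come from a
function on faces. -/
lemma sum_mul_eq_zero [Fintype D] (h : B → ℤ) :
    ∑ d, (h (S.pt (S.rev d)) - h (S.pt d)) * (h (S.fc d) - h (S.fc (S.rev d))) = 0 := by
  -- The increments of `h` along the boundary of each face telescope.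
  have e1 : ∑ d, (h (S.pt (S.rev d)) - h (S.pt d)) * h (S.fc d) = 0 := by
    have := S.sum_next fun d => h (S.pt d) * h (S.fc d)
    simp only [S.pt_next, S.fc_next] at this
    simp only [sub_mul, Finset.sum_sub_distrib, this, sub_self]
  have e2 := S.sum_rev fun d => (h (S.pt (S.rev d)) - h (S.pt d)) * h (S.fc d)
  simp only [S.rev_rev, e1] at e2
  calc _ = ∑ d, ((h (S.pt (S.rev d)) - h (S.pt d)) * h (S.fc d)
        + (h (S.pt d) - h (S.pt (S.rev d))) * h (S.fc (S.rev d))) :=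
        Finset.sum_congr rfl fun d _ => by ring
    _ = 0 := by rw [Finset.sum_add_distrib, e1, e2, add_zero]

/-- If the set `P` is compatible with a choice of joined pairs, no quadrangle has exactly two
corners, which are adjacent, in `P`. -/
lemma same_or_same [Fintype D] {M N : W → B} (hrule : ∀ w, S.Joins w (M w) (N w)) {P : B → Prop}
    (hP : ∀ w, P (M w) ↔ P (N w)) (d : D) :
    (P (S.pt (S.rev d)) ↔ P (S.pt d)) ∨ (P (S.fc d) ↔ P (S.fc (S.rev d))) := by
  set h : B → ℤ := fun b => if P b then 1 else 0 with hh
  -- Joined opposite corners make a factor vanish. A joined adjacent pair with common value `a`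
  -- gives `(x - a) * (a - y)`, or the same with both signs changed, and this is nonpositive since
  -- `a` is an extreme value, `0` or `1`. The other kind of side would give the opposite sign.
  have key : ∀ d, (h (S.pt (S.rev d)) - h (S.pt d)) * (h (S.fc d) - h (S.fc (S.rev d))) ≤ 0 := by
    intro d
    obtain ⟨d', hd', hr⟩ := hrule (S.wt d)
    have hP := hP (S.wt d)
    rcases S.eq_or_eq_rev d d' hd' with rfl | rfl <;> (try simp only [S.rev_rev] at hr) <;>
    rcases hr with ⟨e1, e2⟩ | ⟨e1, e2⟩ | ⟨e1, e2⟩ | ⟨e1, e2⟩ <;> rw [e1, e2] at hP <;>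
    simp only [hh, hP] <;> split_ifs <;> simp
  have h0 := (Finset.sum_eq_zero_iff_of_nonpos fun d _ => key d).1 (S.sum_mul_eq_zero h) d
    (Finset.mem_univ d)
  rcases mul_eq_zero.1 h0 with h0 | h0
  · left
    simp only [hh] at h0
    by_cases a : P (S.pt (S.rev d)) <;> by_cases b : P (S.pt d) <;> simp [a, b] at h0 ⊢
  · right
    simp only [hh] at h0
    by_cases a : P (S.fc d) <;> by_cases b : P (S.fc (S.rev d)) <;> simp [a, b] at h0 ⊢

/-- The quadrangle of `w` has all its corners in `P`. -/
def Full (P : B → Prop) (w : W) : Prop :=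
  ∀ d, S.wt d = w → P (S.pt d) ∧ P (S.fc d)

/-- No side of the quadrangle of `w` has its ends in `P`. -/
def Sideless (P : B → Prop) (w : W) : Prop :=
  ∀ d, S.wt d = w → ¬ (P (S.pt d) ∧ P (S.fc d)) ∧ ¬ (P (S.pt (S.rev d)) ∧ P (S.fc d))

/-- Each side belongs to two quadrangles, so it suffices that in each quadrangle half the number of
sides in `P`, plus the sideless term, is at most the right-hand contribution. With four corners in
`P` this reads `2 ≤ 1 + 1`; with three, one of `M w`, `N w` is in `P`, hence both are, and it reads
`1 ≤ 1`; with two opposite corners, the sideless term cancels. Two adjacent corners alone are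
excluded by `same_or_same`. -/
lemma card_sides_le [Fintype D] [Fintype W] {M N : W → B} (hrule : ∀ w, S.Joins w (M w) (N w))
    {P : B → Prop} (hP : ∀ w, P (M w) ↔ P (N w)) :
    Fintype.card {d // P (S.pt d) ∧ P (S.fc d)} +
      Fintype.card {w // P (M w) ∧ S.Sideless P w} ≤
    Fintype.card {w // S.Full P w} + Fintype.card {w // P (M w)} := by
  have hsurj : Function.Surjective S.wt := fun w => (hrule w).imp fun d h => h.1
  simp only [Fintype.card_subtype, Finset.card_filter]
  set f : D → ℕ := fun d => if P (S.pt d) ∧ P (S.fc d) then 1 else 0 with hf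
  have s1 := S.sum_next f
  have s2 := S.sum_rev f
  have s3 := S.sum_rev fun d => f (S.next d)
  beta_reduce at s3
  have w1 := S.sum_wt hsurj fun w => if P (M w) ∧ S.Sideless P w then 1 else 0
  have w2 := S.sum_wt hsurj fun w => if S.Full P w then 1 else 0
  have w3 := S.sum_wt hsurj fun w => if P (M w) then 1 else 0
  -- The four values of `f` are those at the four sides of the quadrangle of `d`. Summing over darts
  -- visits each quadrangle twice, so all counts appear with the factor `4`.
  have key : ∑ d, (f d + f (S.next d) + f (S.rev d) + f (S.next (S.rev d)) +
      2 * (if P (M (S.wt d)) ∧ S.Sideless P (S.wt d) then 1 else 0)) ≤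
      ∑ d, (2 * (if S.Full P (S.wt d) then 1 else 0) + 2 * (if P (M (S.wt d)) then 1 else 0)) := by
    refine Finset.sum_le_sum fun d _ => ?_
    have hs := S.same_or_same hrule hP d
    obtain ⟨d', hd', hr⟩ := hrule (S.wt d)
    have hP := hP (S.wt d)
    have hfull : S.Full P (S.wt d) ↔ (P (S.pt d) ∧ P (S.fc d)) ∧
        (P (S.pt (S.rev d)) ∧ P (S.fc (S.rev d))) := by
      refine ⟨fun h => ⟨h d rfl, h _ (S.wt_rev d)⟩, fun h d' hd' => ?_⟩
      rcases S.eq_or_eq_rev d d' hd' with rfl | rfl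
      exacts [h.1, h.2]
    have hside : S.Sideless P (S.wt d) ↔ ¬ (P (S.pt d) ∧ P (S.fc d)) ∧
        ¬ (P (S.pt (S.rev d)) ∧ P (S.fc d)) ∧ ¬ (P (S.pt (S.rev d)) ∧ P (S.fc (S.rev d))) ∧
        ¬ (P (S.pt d) ∧ P (S.fc (S.rev d))) := by
      refine ⟨fun h => ?_, fun h d' hd' => ?_⟩
      · have h2 := h _ (S.wt_rev d)
        rw [S.rev_rev] at h2
        exact ⟨(h d rfl).1, (h d rfl).2, h2.1, h2.2⟩
      · rcases S.eq_or_eq_rev d d' hd' with rfl | rfl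
        · exact ⟨h.1, h.2.1⟩
        · rw [S.rev_rev]
          exact ⟨h.2.2.1, h.2.2.2⟩
    simp only [hf, S.pt_next, S.fc_next, S.rev_rev, hfull, hside]
    rcases S.eq_or_eq_rev d d' hd' with rfl | rfl <;> (try simp only [S.rev_rev] at hr hs hP ⊢) <;>
    rcases hr with ⟨e1, e2⟩ | ⟨e1, e2⟩ | ⟨e1, e2⟩ | ⟨e1, e2⟩ <;> rw [e1, e2] at hP <;>
    rw [e1] <;> clear e1 e2 hfull hside <;> revert hs hP <;>
    generalize P (S.pt _) = a <;> generalize P (S.pt _) = b <;>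
    generalize P (S.fc _) = c <;> generalize P (S.fc _) = e <;>
    by_cases ha : a <;> by_cases hb : b <;> by_cases hc : c <;> by_cases he : e <;>
    simp [ha, hb, hc, he]
  simp only [Finset.sum_add_distrib, ← Finset.mul_sum] at key
  change (∑ d, f d) + _ ≤ _
  omega


/-- A function that takes equal values at the ends of each side with ends in `P` takes equal values
at joined corners in `P` of a quadrangle with such a side. -/
lemma eq_of_not_sideless {P : B → Prop} {w : W} {b b' : B} (hr : S.Joins w b b') (hb : P b)
    (hb' : P b') {h : B → ℚ} (hside : ∀ d, P (S.pt d) → P (S.fc d) → h (S.pt d) = h (S.fc d))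
    (hsl : ¬ S.Sideless P w) : h b = h b' := by
  -- The side from the final vertex of `d` to its left face is the one attached to `next d`.
  have hside' : ∀ d, P (S.pt (S.rev d)) → P (S.fc d) → h (S.pt (S.rev d)) = h (S.fc d) :=
    fun d k k' => by
      have := hside (S.next d)
      rw [S.pt_next, S.fc_next] at this
      exact this k k'
  obtain ⟨d, rfl, hr⟩ := hr
  have f1 := hside d
  have f2 := hside (S.rev d)
  have f3 := hside' d
  have f4 := hside' (S.rev d)
  rw [S.rev_rev] at f4
  rcases hr with ⟨rfl, rfl⟩ | ⟨rfl, rfl⟩ | ⟨rfl, rfl⟩ | ⟨rfl, rfl⟩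
  · by_cases k : P (S.pt d)
    · rw [← f1 k hb, f4 k hb']
    by_cases k' : P (S.pt (S.rev d))
    · rw [← f3 k' hb, f2 k' hb']
    · refine absurd (fun d' hd' => ?_) hsl
      rcases S.eq_or_eq_rev d d' hd' with rfl | rfl
      · exact ⟨fun h => k h.1, fun h => k' h.1⟩
      · rw [S.rev_rev]
        exact ⟨fun h => k' h.1, fun h => k h.1⟩
  · by_cases k : P (S.fc d)
    · rw [f1 hb k, f3 hb' k]
    by_cases k' : P (S.fc (S.rev d))
    · rw [f4 hb k', f2 hb' k']
    · refine absurd (fun d' hd' => ?_) hsl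
      rcases S.eq_or_eq_rev d d' hd' with rfl | rfl
      · exact ⟨fun h => k h.2, fun h => k h.2⟩
      · exact ⟨fun h => k' h.2, fun h => k' h.2⟩
  · exact f1 hb hb'
  · exact (f1 hb' hb).symm

/-- Half of Euler's formula, as the injectivity of a linear map: potentials `h` on `P` grounded at
`r`, and circulations `c` around full quadrangles, are sent to functions on edges. Gradients and
curls are orthogonal, so a vanishing sum forces both to vanish. -/
lemma card_add_card_le [Fintype D] [Fintype B] [Fintype W] {M N : W → B}
    (hrule : ∀ w, S.Joins w (M w) (N w))
    {P : B → Prop} (hP : ∀ w, P (M w) ↔ P (N w)) {r : B}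
    (hconst : ∀ h : B → ℚ, h r = 0 → (∀ b, ¬ P b → h b = 0) →
      (∀ d, P (S.pt d) → P (S.fc d) → h (S.pt d) = h (S.fc d)) →
      (∀ w, P (M w) → h (M w) = h (N w)) → ∀ b, h b = 0)
    (hne : ∃ w, ¬ S.Full P w) :
    Fintype.card {b // P b ∧ b ≠ r} + Fintype.card {w // S.Full P w} ≤
      Fintype.card {d // P (S.pt d) ∧ P (S.fc d)} +
      Fintype.card {w // P (M w) ∧ S.Sideless P w} := by
  let eB : ({b // P b ∧ b ≠ r} → ℚ) →ₗ[ℚ] (B → ℚ) := Function.ExtendByZero.linearMap ℚ Subtype.val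
  let eW : ({w // S.Full P w} → ℚ) →ₗ[ℚ] (W → ℚ) := Function.ExtendByZero.linearMap ℚ Subtype.val
  have eB_not : ∀ h b, ¬ (P b ∧ b ≠ r) → eB h b = 0 := fun h b hb =>
    Function.extend_apply' _ _ _ (by rintro ⟨b', rfl⟩; exact hb b'.2)
  have eB_coe : ∀ h (b : {b // P b ∧ b ≠ r}), eB h b = h b := fun h b =>
    Subtype.val_injective.extend_apply _ _ _
  have eW_not : ∀ c w, ¬ S.Full P w → eW c w = 0 := fun c w hw =>
    Function.extend_apply' _ _ _ (by rintro ⟨w', rfl⟩; exact hw w'.2)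
  have eW_coe : ∀ c (w : {w // S.Full P w}), eW c w = c w := fun c w =>
    Subtype.val_injective.extend_apply _ _ _
  -- The side of `d` separates the quadrangles of `d` and of `next.symm d`, so the first component
  -- is the gradient of `h` plus the curl of `c` across that side. A diagonal lies in a quadrangle
  -- that is not full, and sees only `h`.
  let Ψ : (({b // P b ∧ b ≠ r} → ℚ) × ({w // S.Full P w} → ℚ)) →ₗ[ℚ]
      (({d // P (S.pt d) ∧ P (S.fc d)} → ℚ) × ({w // P (M w) ∧ S.Sideless P w} → ℚ)) :=
    { toFun := fun x =>
        (fun d => (eB x.1 (S.fc d) - eB x.1 (S.pt d)) +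
            (eW x.2 (S.wt d) - eW x.2 (S.wt (S.next.symm d))),
          fun w => eB x.1 (M w) - eB x.1 (N w))
      map_add' := fun x y => by
        ext <;> simp only [Prod.fst_add, Prod.snd_add, map_add, Pi.add_apply] <;> ring
      map_smul' := fun a x => by
        ext <;> simp only [Prod.smul_fst, Prod.smul_snd, map_smul, Pi.smul_apply, smul_eq_mul,
          RingHom.id_apply] <;> ring }
  have hinj : Function.Injective Ψ := by
    rw [← LinearMap.ker_eq_bot, LinearMap.ker_eq_bot']
    rintro ⟨x, y⟩ hΨ
    have h1 : ∀ d, P (S.pt d) → P (S.fc d) → (eB x (S.fc d) - eB x (S.pt d)) +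
        (eW y (S.wt d) - eW y (S.wt (S.next.symm d))) = 0 := fun d h h' =>
      congrFun (congrArg Prod.fst hΨ) ⟨d, h, h'⟩
    have h2 : ∀ w, P (M w) → S.Sideless P w → eB x (M w) - eB x (N w) = 0 := fun w h h' =>
      congrFun (congrArg Prod.snd hΨ) ⟨w, h, h'⟩
    set h := eB x with hh
    set c : D → ℚ := fun d => eW y (S.wt d) with hc
    -- All sides of a full quadrangle have their ends in `P`. Hence the curl vanishes on the other
    -- sides, and the sums below can run over all darts.
    have hc0 : ∀ d, ¬ (P (S.pt d) ∧ P (S.fc d)) → c d = 0 ∧ c (S.next.symm d) = 0 := by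
      refine fun d hd => ⟨eW_not _ _ fun hf => hd (hf d rfl), eW_not _ _ fun hf => hd ?_⟩
      have k1 := (hf _ rfl).2
      have k2 := (hf _ (S.wt_rev _)).1
      rw [← S.fc_next, Equiv.apply_symm_apply] at k1
      rw [← S.pt_next, Equiv.apply_symm_apply] at k2
      exact ⟨k2, k1⟩
    have crev : ∀ d, c (S.rev d) = c d := fun d => by simp only [hc, S.wt_rev]
    have horth : ∑ d, (h (S.fc d) - h (S.pt d)) * (c d - c (S.next.symm d)) = 0 := by
      have n1 := S.sum_next fun d => (h (S.fc d) - h (S.pt d)) * c (S.next.symm d)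
      simp only [S.fc_next, S.pt_next, Equiv.symm_apply_apply] at n1
      have n2 := S.sum_rev fun d => h (S.pt (S.rev d)) * c d
      simp only [S.rev_rev, crev] at n2
      simp only [mul_sub, Finset.sum_sub_distrib]
      rw [← n1]
      simp only [sub_mul, Finset.sum_sub_distrib]
      rw [n2]
      ring
    -- In the kernel the gradient is the opposite of the curl wherever the curl can be nonzero, so
    -- `horth` becomes a vanishing sum of squares.
    have hsq : ∀ d, (h (S.fc d) - h (S.pt d)) * (c d - c (S.next.symm d)) =
        - (c d - c (S.next.symm d)) ^ 2 := by
      intro d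
      by_cases hd : P (S.pt d) ∧ P (S.fc d)
      · have := h1 d hd.1 hd.2
        have : h (S.fc d) - h (S.pt d) = - (c d - c (S.next.symm d)) := by
          simp only [hc]; linarith
        rw [this]; ring
      · rw [(hc0 d hd).1, (hc0 d hd).2]; ring
    have hcnext : ∀ d, c d - c (S.next.symm d) = 0 := by
      simp only [hsq, Finset.sum_neg_distrib, neg_eq_zero] at horth
      intro d
      exact pow_eq_zero_iff two_ne_zero |>.1
        ((Finset.sum_eq_zero_iff_of_nonneg fun d _ => sq_nonneg _).1 horth d (Finset.mem_univ d))
    have hczero : ∀ d, c d = 0 := by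
      obtain ⟨w, hw⟩ := hne
      obtain ⟨d₀, hd₀, -⟩ := hrule w
      intro d
      rw [S.connected c crev (fun d => by
        have := hcnext (S.next d)
        rw [Equiv.symm_apply_apply] at this
        linarith) d d₀]
      exact eW_not _ _ (hd₀ ▸ hw)
    have hhzero : ∀ b, h b = 0 := by
      have hside : ∀ d, P (S.pt d) → P (S.fc d) → h (S.pt d) = h (S.fc d) := fun d k k' => by
        have := h1 d k k'
        have e1 : eW y (S.wt d) = 0 := hczero d
        have e2 : eW y (S.wt (S.next.symm d)) = 0 := hczero _
        linarith
      refine hconst h (eB_not _ _ (by simp)) (fun b hb => eB_not _ _ (by tauto)) hside ?_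
      intro w hw
      by_cases hsl : S.Sideless P w
      · exact sub_eq_zero.1 (h2 w hw hsl)
      · exact S.eq_of_not_sideless (hrule w) hw ((hP w).1 hw) hside hsl
    ext i
    · exact (eB_coe x i).symm.trans (hhzero _)
    · obtain ⟨d, hd, -⟩ := hrule i.1
      exact (eW_coe y i).symm.trans (hd ▸ hczero d)
  have := LinearMap.finrank_le_finrank_of_injective hinj
  simpa only [Module.finrank_prod, Module.finrank_pi] using this

/-- A perfect matching of the edges of a map with the vertices and the faces other than a vertex `r`
and a face `s` with a common corner, followed by joined corners, defines a path from any vertex or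
face other than `r` to `s`. -/
theorem reaches [Finite D] [Finite B] [Finite W] {M N : W → B}
    (hrule : ∀ w, S.Joins w (M w) (N w)) {r s : B} (hrs : r ≠ s)
    (hcorner : ∃ d, S.pt d = r ∧ S.fc d = s) (hinj : Function.Injective M)
    (hMr : ∀ w, M w ≠ r) (hMs : ∀ w, M w ≠ s) (hNr : ∀ w, N w ≠ r)
    (hM : ∀ b, b ≠ r → b ≠ s → ∃ w, M w = b) (b : B) (hb : b ≠ r) :
    Relation.ReflTransGen (fun b b' => ∃ w, M w = b ∧ N w = b') b s := by
  have := Fintype.ofFinite D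
  have := Fintype.ofFinite B
  have := Fintype.ofFinite W
  set R := Relation.ReflTransGen (fun b b' => ∃ w, M w = b ∧ N w = b') with hR
  -- Including `r` makes the final count strict: `r` is unmatched like `s`, yet tied to it by the
  -- common corner.
  obtain ⟨P, hPd⟩ : ∃ P : B → Prop, ∀ b, P b ↔ b = r ∨ R b s := ⟨_, fun _ => Iff.rfl⟩
  by_contra hbs
  have hPs : P s := (hPd s).2 (Or.inr Relation.ReflTransGen.refl)
  have hP : ∀ w, P (M w) ↔ P (N w) := by
    intro w
    simp only [hPd, hMr w, hNr w, false_or]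
    refine ⟨fun h => ?_, fun h => Relation.ReflTransGen.head ⟨w, rfl, rfl⟩ h⟩
    -- By injectivity of `M`, the only arrow out of `M w` goes to `N w`, so membership in `P` passes
    -- forwards as well as backwards.
    rcases Relation.ReflTransGen.cases_head h with h | ⟨b', ⟨w', e1, e2⟩, h⟩
    · exact absurd h (hMs w)
    · obtain rfl := hinj e1
      rwa [e2]
  have hle := S.card_add_card_le hrule hP (r := r) (fun h h0 hnot hside hMN b => by
    obtain ⟨d, hd, hd'⟩ := hcorner
    have hs : h s = 0 := by
      have := hside d ((hPd _).2 (Or.inl hd)) (hd' ▸ hPs)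
      rw [← hd', ← this, hd, h0]
    by_cases hPb : P b
    · rcases (hPd b).1 hPb with rfl | hR'
      · exact h0
      · clear hPb hb hbs
        induction hR' using Relation.ReflTransGen.head_induction_on with
        | refl => exact hs
        | head h1 h2 ih =>
          obtain ⟨w, rfl, rfl⟩ := h1
          rw [hMN w ((hP w).2 ((hPd _).2 (Or.inr h2))), ih]
    · exact hnot b hPb) (by
    obtain ⟨w, rfl⟩ := hM b hb (fun e => hbs (e ▸ Relation.ReflTransGen.refl))
    obtain ⟨d, hd, hr⟩ := hrule w
    have hn : ¬ P (M w) := by simp [hPd, hMr, hbs]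
    refine ⟨w, fun hf => hn ?_⟩
    have := hf d hd
    have hd2 := hf (S.rev d) (by rw [S.wt_rev, hd])
    rcases hr with ⟨e1, e2⟩ | ⟨e1, e2⟩ | ⟨e1, e2⟩ | ⟨e1, e2⟩ <;> rw [e1]
    exacts [this.2, this.1, this.1, this.2])
  have hle' := S.card_sides_le hrule hP
  -- The additional element `none` is sent to `s`, which no `M w` equals.
  have hcard : Fintype.card {w // P (M w)} + 1 ≤ Fintype.card {b // P b ∧ b ≠ r} := by
    rw [← Fintype.card_option]
    refine Fintype.card_le_of_injective (fun o => match o with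
      | none => ⟨s, hPs, hrs.symm⟩
      | some w => ⟨M w, w.2, hMr w⟩) ?_
    rintro (_ | w) (_ | w') e
    · rfl
    · exact absurd (congrArg Subtype.val e).symm (hMs _)
    · exact absurd (congrArg Subtype.val e) (hMs _)
    · exact congrArg some (Subtype.ext (hinj (congrArg Subtype.val e)))
  omega

end QuadSystem

/-! ### Oriented spanning trees from matchings and exits -/

namespace BipMultigraph

variable {B W E : Type*} (Γ : BipMultigraph B W E)

/-- A deterministic relation whose paths all lead to a vertex without exit has no cycle. -/
lemma not_transGen_self {α : Type*} {R : α → α → Prop} {r : α}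
    (hdet : ∀ a b c, R a b → R a c → b = c) (hr : ∀ a, ¬ R r a)
    (hreach : ∀ a, Relation.ReflTransGen R a r) (a : α) : ¬ Relation.TransGen R a a := by
  induction hreach a using Relation.ReflTransGen.head_induction_on with
  | refl =>
    intro h
    obtain ⟨b, hb, -⟩ := Relation.TransGen.head'_iff.1 h
    exact hr b hb
  | head h1 _ ih =>
    intro h
    -- Determinism turns a cycle through a vertex into a cycle through its successor, which is
    -- excluded by induction along the path to `r`.
    obtain ⟨b, hb, hba⟩ := Relation.TransGen.head'_iff.1 h
    obtain rfl := hdet _ _ _ h1 hb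
    exact ih (Relation.TransGen.tail' hba h1)

/-- The root of an oriented spanning tree has no exit. -/
lemma IsOST.not_step [Finite B] [Finite W] {Γ : BipMultigraph B W E} {r : B ⊕ W}
    {T : Finset (E × Bool)} (hT : Γ.IsOST r T) (v : B ⊕ W) : ¬ Γ.Step T r v := by
  intro hv
  have : Std.Irrefl (fun a b => Relation.TransGen (Γ.Step T) b a) := ⟨hT.2⟩
  have : IsTrans _ (fun a b => Relation.TransGen (Γ.Step T) b a) :=
    ⟨fun a b c h h' => h'.trans h⟩
  -- A finite acyclic orientation has a sink, and only the root can be one.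
  have hwf : WellFounded (fun a b => Relation.TransGen (Γ.Step T) b a) :=
    Finite.wellFounded_of_trans_of_irrefl _
  obtain ⟨m, -, hm⟩ := hwf.has_min Set.univ ⟨r, trivial⟩
  by_cases h : m = r
  · exact hm v trivial (h ▸ Relation.TransGen.single hv)
  · obtain ⟨a, ⟨ha, ha'⟩, -⟩ := hT.1 m h
    exact hm _ trivial (Relation.TransGen.single ⟨a, ha, ha', rfl⟩)

lemma IsOST.not_both {Γ : BipMultigraph B W E} {r : B ⊕ W} {T : Finset (E × Bool)}
    (hT : Γ.IsOST r T) {h : E} (h1 : (h, true) ∈ T) (h2 : (h, false) ∈ T) : False :=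
  hT.2 (Sum.inl (Γ.black h)) (Relation.TransGen.tail
    (Relation.TransGen.single ⟨_, h1, rfl, rfl⟩) ⟨_, h2, rfl, rfl⟩)

/-- The edges `M` oriented from black to white, and the edges `n w` oriented from white to black. -/
def configuration [Fintype W] (M : Finset E) (n : W → E) : Finset (E × Bool) :=
  M.image (fun h => (h, true)) ∪
    Finset.univ.image fun w => (n w, false)

@[simp] lemma mem_configuration_true [Fintype W] {M : Finset E} {n : W → E} {h : E} :
    (h, true) ∈ configuration M n ↔ h ∈ M := by
  simp [configuration]

@[simp] lemma mem_configuration_false [Fintype W] {M : Finset E} {n : W → E} {h : E} :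
    (h, false) ∈ configuration M n ↔ ∃ w, n w = h := by
  simp [configuration]

lemma prod_configuration [Fintype W] {R : Type*} [CommMonoid R] {M : Finset E} {n : W → E}
    (hn : Function.Injective n) (f : E → R) :
    ∏ a ∈ configuration M n, f a.1 = (∏ h ∈ M, f h) * ∏ w, f (n w) := by
  rw [configuration, Finset.prod_union, Finset.prod_image, Finset.prod_image]
  · exact fun w _ w' _ e => hn (Prod.ext_iff.1 e).1
  · exact fun h _ h' _ e => (Prod.ext_iff.1 e).1
  · rw [Finset.disjoint_left]
    simp

/-- The edge of a perfect matching at a white vertex. -/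
lemma IsPerfectMatchingMinus.exists_whiteEdge {s : B} {M : Finset E}
    (hM : Γ.IsPerfectMatchingMinus s M) :
    ∃ m : W → E, (∀ w, m w ∈ M) ∧ (∀ w, Γ.white (m w) = w) ∧ ∀ h ∈ M, m (Γ.white h) = h := by
  choose m hm hm' using hM.2.2
  exact ⟨m, fun w => (hm w).1, fun w => (hm w).2, fun h hh => (hm' _ h ⟨hh, rfl⟩).symm⟩

lemma prod_whiteEdge [Fintype W] {R : Type*} [CommMonoid R] {M : Finset E} {m : W → E}
    (h1 : ∀ w, m w ∈ M) (h2 : ∀ w, Γ.white (m w) = w) (h3 : ∀ h ∈ M, m (Γ.white h) = h)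
    (f : E → R) : ∏ w, f (m w) = ∏ h ∈ M, f h :=
  Finset.prod_bij (fun w _ => m w) (fun w _ => h1 w)
    (fun w _ w' _ e => by rw [← h2 w, e, h2]) (fun h hh => ⟨_, Finset.mem_univ _, h3 h hh⟩)
    fun _ _ => rfl

/-- A perfect matching and a choice of exits from white vertices such that the black vertices lead
to the root give an oriented spanning tree. -/
lemma isOST_configuration [Fintype W] {s : B} {M : Finset E} (hM : Γ.IsPerfectMatchingMinus s M)
    {m n : W → E} (hm : ∀ w, m w ∈ M) (hmw : ∀ w, Γ.white (m w) = w) (hn : ∀ w, Γ.white (n w) = w)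
    (hreach : ∀ b, Relation.ReflTransGen
      (fun b b' => ∃ w, Γ.black (m w) = b ∧ Γ.black (n w) = b') b s) :
    Γ.IsOST (Sum.inl s) (configuration M n) := by
  have hex : ∀ v, v ≠ Sum.inl s → ∃! a, a ∈ configuration M n ∧ Γ.src a = v := by
    rintro (b | w) hv
    · obtain ⟨h, ⟨hh, hb⟩, hu⟩ := hM.2.1 b fun e => hv (congrArg _ e)
      refine ⟨(h, true), ⟨mem_configuration_true.2 hh, by simp [src, hb]⟩, ?_⟩
      rintro ⟨h', _ | _⟩ ⟨h1, h2⟩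
      · simp [src] at h2
      · rw [mem_configuration_true] at h1
        rw [hu h' ⟨h1, by simpa [src] using h2⟩]
    · refine ⟨(n w, false), ⟨mem_configuration_false.2 ⟨w, rfl⟩, by simp [src, hn]⟩, ?_⟩
      rintro ⟨h', _ | _⟩ ⟨h1, h2⟩
      · obtain ⟨w', rfl⟩ := mem_configuration_false.1 h1
        have : w' = w := by simpa [src, hn] using h2
        rw [this]
      · simp [src] at h2
  have hs : ∀ v, ¬ Γ.Step (configuration M n) (Sum.inl s) v := by
    rintro v ⟨⟨h, _ | _⟩, h1, h2, -⟩
    · simp [src] at h2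
    · exact hM.1 h (mem_configuration_true.1 h1) (by simpa [src] using h2)
  refine ⟨hex, not_transGen_self (r := Sum.inl s) ?_ hs ?_⟩
  · rintro v v₁ v₂ ⟨a, h1, h2, rfl⟩ ⟨a', h1', h2', rfl⟩
    have hv : v ≠ Sum.inl s := by
      rintro rfl
      exact hs _ ⟨a, h1, h2, rfl⟩
    rw [(hex v hv).unique ⟨h1, h2⟩ ⟨h1', h2'⟩]
  · have hb : ∀ b, Relation.ReflTransGen (Γ.Step (configuration M n)) (Sum.inl b) (Sum.inl s) := by
      intro b
      induction hreach b using Relation.ReflTransGen.head_induction_on with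
      | refl => exact Relation.ReflTransGen.refl
      | head h _ ih =>
        obtain ⟨w, rfl, rfl⟩ := h
        refine Relation.ReflTransGen.head (b := Sum.inr w) ?_
          (Relation.ReflTransGen.head ?_ ih)
        · exact ⟨(m w, true), mem_configuration_true.2 (hm w), by simp [src], by simp [tgt, hmw]⟩
        · exact ⟨(n w, false), mem_configuration_false.2 ⟨w, rfl⟩, by simp [src, hn],
            by simp [tgt]⟩
    rintro (b | w)
    · exact hb b
    · exact Relation.ReflTransGen.head ⟨(n w, false), mem_configuration_false.2 ⟨w, rfl⟩,
        by simp [src, hn], by simp [tgt]⟩ (hb (Γ.black (n w)))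

end BipMultigraph

/-! ### The extended map as a quadrangle system -/

namespace PlanarMap

variable {V : Type*} {G : SimpleGraph V} (P : PlanarMap G)

/-- The next boundary edge, as a permutation. -/
def bdNextPerm : Equiv.Perm P.BdDart where
  toFun := P.bdNext
  invFun b := ⟨(faceNext P.rot).symm b.1, by
    rw [← P.leftFace_faceNext, Equiv.apply_symm_apply, b.2]⟩
  left_inv b := Subtype.ext (Equiv.symm_apply_apply _ _)
  right_inv b := Subtype.ext (Equiv.apply_symm_apply _ _)

lemma leftDual_of_eq {d : G.Dart} (h : P.leftFace d = P.outer) : P.leftDual d = .bdry ⟨d, h⟩ :=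
  dif_pos h

lemma leftDual_of_ne {d : G.Dart} (h : P.leftFace d ≠ P.outer) :
    P.leftDual d = .inner ⟨P.leftFace d, h⟩ :=
  dif_neg h

lemma leftDual_congr {d d' : G.Dart} (h : P.leftFace d ≠ P.outer)
    (e : P.leftFace d' = P.leftFace d) : P.leftDual d' = P.leftDual d := by
  rw [P.leftDual_of_ne h, P.leftDual_of_ne (e ▸ h)]
  simp only [e]

/-- A function of the darts of a connected graph that is invariant under reversal and under passage
to the next dart along a face is constant. -/
lemma eq_of_invariant {α : Type*} (hconn : G.Connected) {c : G.Dart → α}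
    (hrev : ∀ d, c d.symm = c d) (hnext : ∀ d, c (faceNext P.rot d) = c d) (d d' : G.Dart) :
    c d = c d' := by
  have hrot : ∀ d, c (P.rot d) = c d := by
    intro d
    have := hnext (P.rot d).symm
    rw [hrev] at this
    rw [← this]
    simp [faceNext, dartRev]
  have hzpow : ∀ (i : ℤ) d, c ((P.rot ^ i) d) = c d := by
    intro i
    induction i using Int.induction_on with
    | zero => simp
    | succ i ih => intro d; rw [zpow_add_one, Equiv.Perm.mul_apply, ih, hrot]
    | pred i ih =>
      intro d
      rw [zpow_sub_one, Equiv.Perm.mul_apply, ih, ← hrot ((P.rot)⁻¹ d)]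
      exact congrArg c (P.rot.apply_symm_apply d)
  have hfst : ∀ d d' : G.Dart, d.fst = d'.fst → c d = c d' := by
    intro d d' h
    obtain ⟨i, rfl⟩ := (P.rot_sameCycle d d').2 h
    exact (hzpow i d).symm
  obtain ⟨p⟩ := hconn.preconnected d.fst d'.fst
  generalize hv : d.fst = v at p
  generalize hw : d'.fst = w at p
  induction p generalizing d with
  | nil => exact hfst d d' (hv.trans hw.symm)
  | cons h _ ih =>
    rw [hfst d ⟨(_, _), h⟩ hv, ← hrev]
    exact ih _ rfl hw

/-- The quadrangles of the extended graph, whose darts are those of `G`, the darts from `b.snd` to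
the outer vertex, and their reversals. -/
def extQuads (hconn : G.Connected) :
    QuadSystem (G.Dart ⊕ (P.BdDart ⊕ P.BdDart)) (Option P.DoubleBlack) P.DoubleWhite where
  rev
    | .inl d => .inl d.symm
    | .inr (.inl b) => .inr (.inr b)
    | .inr (.inr b) => .inr (.inl b)
  -- Each boundary dart `b` yields a triangular face of the extended graph: `b`, then `b.snd` to
  -- `r`, then `r` back to `b.fst`, the last dart being indexed by the boundary dart preceding `b`.
  -- The vertex `r` is `none`.
  next :=
    { toFun := fun
        | .inl d => if h : P.leftFace d = P.outer then .inr (.inl ⟨d, h⟩)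
            else .inl (faceNext P.rot d)
        | .inr (.inl b) => .inr (.inr (P.bdNextPerm.symm b))
        | .inr (.inr b) => .inl (P.bdNext b).1
      invFun := fun
        | .inl d => if h : P.leftFace d = P.outer then .inr (.inr (P.bdNextPerm.symm ⟨d, h⟩))
            else .inl ((faceNext P.rot).symm d)
        | .inr (.inl b) => .inl b.1
        | .inr (.inr b) => .inr (.inl (P.bdNextPerm b))
      left_inv := by
        rintro (d | b | b)
        · by_cases h : P.leftFace d = P.outer
          · simp [h]
          · simp [h, P.leftFace_faceNext]
        · simp
        · have h := (P.bdNext b).2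
          simp only [h, dif_pos, Subtype.coe_eta]
          exact congrArg (fun b => Sum.inr (Sum.inr b)) (P.bdNextPerm.symm_apply_apply b)
      right_inv := by
        rintro (d | b | b)
        · by_cases h : P.leftFace d = P.outer
          · simp only [h, dif_pos]
            exact congrArg (fun b => Sum.inl (Subtype.val b))
              (P.bdNextPerm.apply_symm_apply ⟨d, h⟩)
          · have h' : P.leftFace ((faceNext P.rot).symm d) ≠ P.outer := by
              rwa [← P.leftFace_faceNext, Equiv.apply_symm_apply]
            simp [h, h']
        · simp [b.2]
        · simp }
  pt
    | .inl d => some (.primal d.fst)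
    | .inr (.inl b) => some (.primal b.1.snd)
    | .inr (.inr _) => none
  fc
    | .inl d => some (P.leftDual d)
    | .inr (.inl b) => some (.bdry b)
    | .inr (.inr b) => some (.bdry (P.bdNext b))
  wt
    | .inl d => .edge ⟨d.edge, d.edge_mem⟩
    | .inr (.inl b) => .bdry b
    | .inr (.inr b) => .bdry b
  rev_rev := by rintro (d | b | b) <;> simp
  rev_ne := by
    rintro (d | b | b)
    · simpa using d.symm_ne
    · simp
    · simp
  pt_next := by
    rintro (d | b | b)
    · by_cases h : P.leftFace d = P.outer
      · simp [h]
      · simp [h, P.faceNext_fst]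
    · simp
    · simp [bdNext, P.faceNext_fst]
  fc_next := by
    rintro (d | b | b)
    · by_cases h : P.leftFace d = P.outer
      · simp [h, P.leftDual_of_eq h]
      · simp [h, P.leftDual_congr h (P.leftFace_faceNext d)]
    · exact congrArg (fun b => some (DoubleBlack.bdry b)) (P.bdNextPerm.apply_symm_apply b)
    · exact congrArg some (P.leftDual_of_eq (P.bdNext b).2)
  wt_rev := by rintro (d | b | b) <;> simp
  eq_or_eq_rev := by
    rintro (d | b | b) (d' | b' | b') h <;> simp at h ⊢
    · exact (SimpleGraph.dart_edge_eq_iff d' d).1 h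
    all_goals exact h
  connected := by
    intro c hrev hnext
    have hb : ∀ b, c (.inr (.inl b)) = c (.inl b.1) := by
      intro b
      rw [← hnext (.inl b.1)]
      simp [b.2]
    have hb' : ∀ b, c (.inr (.inr b)) = c (.inl b.1) := fun b =>
      (hrev (.inr (.inl b))).trans (hb b)
    have hG := P.eq_of_invariant hconn (c := fun d => c (.inl d)) (fun d => hrev (.inl d)) (by
      intro d
      by_cases h : P.leftFace d = P.outer
      · exact (hnext (.inr (.inr ⟨d, h⟩))).trans (hb' ⟨d, h⟩)
      · rw [← hnext (.inl d)]
        simp [h])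
    rintro (d | b | b) (d' | b' | b') <;> (try simp only [hb, hb']) <;> exact hG _ _

/-! ### Local constraints as choices of mates -/

/-- The half-edges that the local constraints allow together with a given one. -/
def mates : P.DoubleEdge → Finset P.DoubleEdge
  | .primalHalf d => {.dualHalf d, .primalHalf d.symm}
  | .dualHalf d => {.dualHalf d.symm, .primalHalf d}
  | .bdPrimal b => {.bdFirst b}
  | .bdFirst b => {.bdSecond b, .bdPrimal b}
  | .bdSecond b => {.bdFirst b}

lemma white_of_mem_mates {h h' : P.DoubleEdge} (hh : h' ∈ P.mates h) :
    P.extDouble.white h' = P.extDouble.white h := by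
  cases h <;> simp only [mates, Finset.mem_insert, Finset.mem_singleton] at hh <;>
    rcases hh with rfl | rfl <;> simp [extDouble]

/-- This is where the chirality of the rule meets that of `Joins`. At a boundary white vertex, the
dart from `b.snd` to `r` has `bdry b` on its left, which is why `bdPrimal b` is paired with `bdFirst
b` and not with `bdSecond b`. -/
lemma joins_of_mem_mates (hconn : G.Connected) {h h' : P.DoubleEdge} (hh : h' ∈ P.mates h) :
    (P.extQuads hconn).Joins (P.extDouble.white h) (some (P.extDouble.black h))
      (some (P.extDouble.black h')) := by
  cases h with
  | primalHalf d =>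
    refine ⟨.inl d, rfl, ?_⟩
    simp only [mates, Finset.mem_insert, Finset.mem_singleton] at hh
    rcases hh with rfl | rfl <;> simp [extDouble, extQuads]
  | dualHalf d =>
    refine ⟨.inl d, rfl, ?_⟩
    simp only [mates, Finset.mem_insert, Finset.mem_singleton] at hh
    rcases hh with rfl | rfl <;> simp [extDouble, extQuads]
  | bdFirst b =>
    refine ⟨.inr (.inl b), rfl, ?_⟩
    simp only [mates, Finset.mem_insert, Finset.mem_singleton] at hh
    rcases hh with rfl | rfl <;> simp [extDouble, extQuads]
  | bdPrimal b =>
    refine ⟨.inr (.inl b), rfl, ?_⟩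
    simp only [mates, Finset.mem_singleton] at hh
    subst hh
    simp [extDouble, extQuads]
  | bdSecond b =>
    refine ⟨.inr (.inr b), rfl, ?_⟩
    simp only [mates, Finset.mem_singleton] at hh
    subst hh
    simp [extDouble, extQuads]

lemma finite_dart [Finite V] : Finite G.Dart :=
  Finite.of_injective (fun d => d.toProd) SimpleGraph.Dart.toProd_injective

attribute [local instance] finite_dart

/-- White vertices are edges and boundary edges. -/
def doubleWhiteEquiv : G.edgeSet ⊕ P.BdDart ≃ P.DoubleWhite where
  toFun := Sum.elim .edge .bdry
  invFun
    | .edge e => .inl e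
    | .bdry b => .inr b
  left_inv := by rintro (_ | _) <;> rfl
  right_inv := by rintro (_ | _) <;> rfl

instance [Finite V] : Finite P.DoubleWhite := Finite.of_equiv _ P.doubleWhiteEquiv

instance [Finite V] : Fintype P.DoubleWhite := Fintype.ofFinite _

instance [Finite V] : Finite P.DoubleBlack := by
  refine Finite.of_surjective
    (fun x : V ⊕ (P.InnerFace ⊕ P.BdDart) =>
      match x with
      | .inl v => DoubleBlack.primal v
      | .inr (.inl f) => DoubleBlack.inner f
      | .inr (.inr b) => DoubleBlack.bdry b) ?_
  rintro (v | f | b)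
  exacts [⟨.inl v, rfl⟩, ⟨.inr (.inl f), rfl⟩, ⟨.inr (.inr b), rfl⟩]

/-- If the exits from white vertices are allowed by the matching, the black vertices lead to the
root. -/
lemma reflTransGen_root [Finite V] (hconn : G.Connected) {s : P.BdDart} {M : Finset P.DoubleEdge}
    (hM : P.extDouble.IsPerfectMatchingMinus (.bdry s) M) {m n : P.DoubleWhite → P.DoubleEdge}
    (hm : ∀ w, m w ∈ M) (hmw : ∀ w, P.extDouble.white (m w) = w)
    (hmM : ∀ h ∈ M, m (P.extDouble.white h) = h) (hn : ∀ w, n w ∈ P.mates (m w))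
    (b : P.DoubleBlack) :
    Relation.ReflTransGen
      (fun b b' => ∃ w, P.extDouble.black (m w) = b ∧ P.extDouble.black (n w) = b') b (.bdry s) := by
  have hfin : ∀ b, b ≠ none → Relation.ReflTransGen
      (fun b b' => ∃ w, some (P.extDouble.black (m w)) = b ∧ some (P.extDouble.black (n w)) = b') b
      (some (.bdry s)) := by
    refine (P.extQuads hconn).reaches (M := fun w => some (P.extDouble.black (m w)))
      (N := fun w => some (P.extDouble.black (n w))) (fun w => ?_) (by simp)
      -- The dart from `r` that has the root `bdry s` on its left.
      ⟨.inr (.inr (P.bdNextPerm.symm s)), rfl, ?_⟩ ?_ (by simp) ?_ (by simp) ?_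
    · have := P.joins_of_mem_mates hconn (hn w)
      rwa [hmw] at this
    · exact congrArg (fun b => some (DoubleBlack.bdry b)) (P.bdNextPerm.apply_symm_apply s)
    · intro w w' h
      have h := Option.some_injective _ h
      have := (hM.2.1 _ (hM.1 _ (hm w'))).unique ⟨hm w, h⟩ ⟨hm w', rfl⟩
      rw [← hmw w, this, hmw]
    · exact fun w h => hM.1 _ (hm w) (Option.some_injective _ h)
    · rintro (_ | b) h0 hb
      · exact absurd rfl h0
      · obtain ⟨h, ⟨hh, rfl⟩, -⟩ := hM.2.1 b fun e => hb (congrArg some e)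
        exact ⟨P.extDouble.white h, by rw [hmM h hh]⟩
  have := hfin (some b) (by simp)
  generalize hb : some b = o at this
  induction this using Relation.ReflTransGen.head_induction_on generalizing b with
  | refl => rw [Option.some_injective _ hb]
  | head h _ ih =>
    obtain ⟨w, hw, rfl⟩ := h
    obtain rfl := Option.some_injective _ (hw.trans hb.symm)
    exact .head ⟨w, rfl, rfl⟩ (ih _ rfl)

lemma ne_symm (d : G.Dart) : d ≠ d.symm := d.symm_ne.symm

lemma ne_of_mem_mates {h h' : P.DoubleEdge} (hh : h' ∈ P.mates h) : h' ≠ h := by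
  rintro rfl
  cases h' <;> simp [mates] at hh <;> exact ne_symm _ hh

variable {P} in
-- Two distinct half-edges at a white vertex that are not mates are the two alternatives of one
-- exclusive disjunction of the rule.
lemma LocalRule.mem_mates {T : Finset (P.DoubleEdge × Bool)} (hT : P.LocalRule T)
    {h h' : P.DoubleEdge} (hh : EdgeUsed T h) (hh' : EdgeUsed T h') (hne : h' ≠ h)
    (hw : P.extDouble.white h' = P.extDouble.white h) : h' ∈ P.mates h := by
  cases h <;> cases h' <;> simp only [extDouble, DoubleWhite.edge.injEq, Subtype.mk.injEq,
    DoubleWhite.bdry.injEq, reduceCtorEq] at hw <;>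
    first
    | (rcases (SimpleGraph.dart_edge_eq_iff _ _).1 hw with rfl | rfl)
    | subst hw
  case primalHalf.primalHalf.inr | dualHalf.dualHalf.inr => simp [mates]
  case primalHalf.dualHalf.inl | dualHalf.primalHalf.inl => simp [mates]
  case primalHalf.dualHalf.inr d =>
    have := hT.1 d.symm
    rw [SimpleGraph.Dart.symm_symm] at this
    exact absurd this (by simp [Xor, hh, hh'])
  case dualHalf.primalHalf.inr d => exact absurd (hT.1 d) (by simp [Xor, hh, hh'])
  case bdPrimal.bdSecond b | bdSecond.bdPrimal b =>
    exact absurd (hT.2 b).2 (by simp [Xor, hh, hh'])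
  all_goals first | exact absurd rfl hne | simp [mates]

variable {P} in
lemma LocalRule.exists_mate {T : Finset (P.DoubleEdge × Bool)} (hT : P.LocalRule T)
    {h : P.DoubleEdge} (hh : EdgeUsed T h) : ∃ h' ∈ P.mates h, EdgeUsed T h' := by
  cases h with
  | primalHalf d =>
    have := hT.1 d
    have h2 := hT.1 d.symm
    rw [SimpleGraph.Dart.symm_symm] at h2
    simp only [mates, Finset.mem_insert, Finset.mem_singleton, exists_eq_or_imp, exists_eq_left]
    rcases this with h | h <;> tauto
  | dualHalf d =>
    have := hT.1 d
    have h2 := hT.1 d.symm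
    rw [SimpleGraph.Dart.symm_symm] at h2
    simp only [mates, Finset.mem_insert, Finset.mem_singleton, exists_eq_or_imp, exists_eq_left]
    rcases h2 with h | h <;> tauto
  | bdPrimal b => exact ⟨_, Finset.mem_singleton_self _, (hT.2 b).1⟩
  | bdSecond b => exact ⟨_, Finset.mem_singleton_self _, (hT.2 b).1⟩
  | bdFirst b =>
    simp only [mates, Finset.mem_insert, Finset.mem_singleton, exists_eq_or_imp, exists_eq_left]
    rcases (hT.2 b).2 with h | h <;> tauto

/-- The mate relation is a four-cycle at an edge crossing and a path at a boundary white vertex, so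
it has no triangle. With `LocalRule.mem_mates`, at most two half-edges are present at a white
vertex. -/
lemma notMem_mates_of_mem_mates {h h₁ h₂ : P.DoubleEdge} (h1 : h₁ ∈ P.mates h)
    (h2 : h₂ ∈ P.mates h) : h₂ ∉ P.mates h₁ := by
  cases h <;> simp only [mates, Finset.mem_insert, Finset.mem_singleton] at h1 h2 <;>
    rcases h1 with rfl | rfl <;> rcases h2 with rfl | rfl <;>
    simp [mates, ne_symm, (ne_symm _).symm]

lemma localRule_of_mates {T : Finset (P.DoubleEdge × Bool)} {m n : P.DoubleWhite → P.DoubleEdge}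
    (hmw : ∀ w, P.extDouble.white (m w) = w) (hn : ∀ w, n w ∈ P.mates (m w))
    (hT : ∀ h, EdgeUsed T h ↔ h = m (P.extDouble.white h) ∨ h = n (P.extDouble.white h)) :
    P.LocalRule T := by
  constructor
  · intro d
    rw [hT, hT]
    have e : P.extDouble.white (.primalHalf d.symm) = P.extDouble.white (.dualHalf d) := by
      simp [extDouble]
    rw [e]
    have h1 := hmw (P.extDouble.white (.dualHalf d))
    have h2 := hn (P.extDouble.white (.dualHalf d))
    generalize m (P.extDouble.white (.dualHalf d)) = x at h1 h2 ⊢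
    generalize n (P.extDouble.white (.dualHalf d)) = y at h2 ⊢
    cases x <;> simp only [extDouble, DoubleWhite.edge.injEq, Subtype.mk.injEq,
      reduceCtorEq] at h1
    all_goals
      rcases (SimpleGraph.dart_edge_eq_iff _ _).1 h1 with rfl | rfl <;>
      simp only [mates, Finset.mem_insert, Finset.mem_singleton] at h2 <;>
      rcases h2 with rfl | rfl <;>
      simp [Xor, ne_symm, (ne_symm _).symm]
  · intro b
    rw [hT, hT, hT]
    have e : P.extDouble.white (.bdSecond b) = P.extDouble.white (.bdFirst b) := rfl
    have e' : P.extDouble.white (.bdPrimal b) = P.extDouble.white (.bdFirst b) := rfl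
    rw [e, e']
    have h1 := hmw (P.extDouble.white (.bdFirst b))
    have h2 := hn (P.extDouble.white (.bdFirst b))
    generalize m (P.extDouble.white (.bdFirst b)) = x at h1 h2 ⊢
    generalize n (P.extDouble.white (.bdFirst b)) = y at h2 ⊢
    cases x <;> simp only [extDouble, DoubleWhite.bdry.injEq, reduceCtorEq] at h1
    all_goals
      subst h1
      simp only [mates, Finset.mem_insert, Finset.mem_singleton] at h2
      rcases h2 with rfl | rfl <;>
      simp [Xor]

/-! ### Factorization of the sum over trees -/

/-- The trees compatible with a matching correspond to the choices of a mate of each of its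
edges. -/
lemma mem_constrainedTreesCompatible_iff [Finite V] (hconn : G.Connected) {s : P.BdDart}
    {M : Finset P.DoubleEdge} (hM : P.extDouble.IsPerfectMatchingMinus (.bdry s) M)
    {m : P.DoubleWhite → P.DoubleEdge} (hm : ∀ w, m w ∈ M)
    (hmw : ∀ w, P.extDouble.white (m w) = w) (hmM : ∀ h ∈ M, m (P.extDouble.white h) = h)
    (T : Finset (P.DoubleEdge × Bool)) :
    T ∈ P.constrainedTreesCompatible s M ↔
      ∃ n ∈ Fintype.piFinset fun w => P.mates (m w), BipMultigraph.configuration M n = T := by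
  simp only [constrainedTreesCompatible, constrainedTrees, Finset.mem_filter, Finset.mem_univ,
    true_and, Fintype.mem_piFinset]
  constructor
  · rintro ⟨⟨hT, hrule⟩, hTM⟩
    have hex : ∀ w, ∃ h, ((h, false) ∈ T ∧ P.extDouble.white h = w) ∧
        ∀ h', (h', false) ∈ T → P.extDouble.white h' = w → h' = h := by
      intro w
      obtain ⟨⟨h, _ | _⟩, ⟨h1, h2⟩, h3⟩ := hT.1 (Sum.inr w) (by simp)
      · refine ⟨h, ⟨h1, by simpa [BipMultigraph.src] using h2⟩, fun h' k1 k2 => ?_⟩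
        exact (Prod.ext_iff.1 (h3 (h', false) ⟨k1, by simp [BipMultigraph.src, k2]⟩)).1
      · simp [BipMultigraph.src] at h2
    choose n hn hn' using hex
    refine ⟨n, fun w => ?_, ?_⟩
    · have hmT := (hTM _).1 (hm w)
      refine hrule.mem_mates (Or.inl hmT) (Or.inr (hn w).1) ?_ ((hn w).2.trans (hmw w).symm)
      intro e
      exact hT.not_both hmT (e ▸ (hn w).1)
    · ext ⟨h, _ | _⟩
      · rw [BipMultigraph.mem_configuration_false]
        constructor
        · rintro ⟨w, rfl⟩
          exact (hn w).1
        · exact fun h1 => ⟨_, (hn' _ h h1 rfl).symm⟩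
      · rw [BipMultigraph.mem_configuration_true, hTM]
  · rintro ⟨n, hn, rfl⟩
    have hnw : ∀ w, P.extDouble.white (n w) = w := fun w =>
      (P.white_of_mem_mates (hn w)).trans (hmw w)
    refine ⟨⟨P.extDouble.isOST_configuration hM hm hmw hnw
      (P.reflTransGen_root hconn hM hm hmw hmM hn), P.localRule_of_mates hmw hn fun h => ?_⟩,
      fun h => BipMultigraph.mem_configuration_true.symm⟩
    rw [EdgeUsed, BipMultigraph.mem_configuration_true, BipMultigraph.mem_configuration_false]
    refine or_congr ⟨fun h1 => (hmM h h1).symm, fun h1 => h1 ▸ hm _⟩ ⟨?_, fun h1 => ⟨_, h1.symm⟩⟩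
    rintro ⟨w, rfl⟩
    rw [hnw]

/-- The weighted sum of the trees compatible with a matching is a product over its edges. -/
lemma treeWeight_compatible [Finite V] (hconn : G.Connected) {s : P.BdDart}
    {M : Finset P.DoubleEdge} (hM : P.extDouble.IsPerfectMatchingMinus (.bdry s) M)
    (f : P.DoubleEdge → ℂ) :
    P.treeWeight (P.constrainedTreesCompatible s M) f = ∏ h ∈ M, f h * ∑ h' ∈ P.mates h, f h' := by
  obtain ⟨m, hm, hmw, hmM⟩ := hM.exists_whiteEdge
  have himage : P.constrainedTreesCompatible s M =
      (Fintype.piFinset fun w => P.mates (m w)).image (BipMultigraph.configuration M) := by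
    ext T
    rw [P.mem_constrainedTreesCompatible_iff hconn hM hm hmw hmM, Finset.mem_image]
  have hnw : ∀ n ∈ Fintype.piFinset fun w => P.mates (m w), ∀ w, P.extDouble.white (n w) = w :=
    fun n hn w => (P.white_of_mem_mates (Fintype.mem_piFinset.1 hn w)).trans (hmw w)
  have hinj : Set.InjOn (BipMultigraph.configuration M)
      (SetLike.coe (Fintype.piFinset fun w => P.mates (m w))) := by
    intro n hn n' hn' e
    funext w
    obtain ⟨w', h⟩ := BipMultigraph.mem_configuration_false.1
      (e ▸ BipMultigraph.mem_configuration_false.2 ⟨w, rfl⟩ :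
        (n w, false) ∈ BipMultigraph.configuration M n')
    have : w' = w := by rw [← hnw n' hn' w', h, hnw n hn]
    rw [← h, this]
  rw [treeWeight, himage, Finset.sum_image hinj, Finset.prod_mul_distrib,
    ← P.extDouble.prod_whiteEdge hm hmw hmM fun h => ∑ h' ∈ P.mates h, f h',
    Finset.prod_univ_sum, Finset.mul_sum]
  refine Finset.sum_congr rfl fun n hn => BipMultigraph.prod_configuration ?_ f
  exact fun w w' e => by rw [← hnw n hn w, e, hnw n hn]

/-- The edges of a constrained tree that exit from black vertices are a perfect matching. -/
lemma exists_compatible_matching [Finite V] {s : P.BdDart} {T : Finset (P.DoubleEdge × Bool)}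
    (hT : T ∈ P.constrainedTrees s) :
    P.extDouble.IsPerfectMatchingMinus (.bdry s)
      (Finset.univ.filter fun h => (h, true) ∈ T) := by
  simp only [constrainedTrees, Finset.mem_filter, Finset.mem_univ, true_and] at hT
  obtain ⟨hT, hrule⟩ := hT
  simp only [BipMultigraph.IsPerfectMatchingMinus, Finset.mem_filter, Finset.mem_univ, true_and]
  refine ⟨fun h hh hb => ?_, fun b hb => ?_, fun w => ?_⟩
  · exact hT.not_step _ ⟨(h, true), hh, by simp [BipMultigraph.src, hb], rfl⟩
  · obtain ⟨⟨h, _ | _⟩, ⟨h1, h2⟩, h3⟩ := hT.1 (Sum.inl b) (by simpa using hb)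
    · simp [BipMultigraph.src] at h2
    · refine ⟨h, ⟨h1, by simpa [BipMultigraph.src] using h2⟩, fun h' k => ?_⟩
      exact (Prod.ext_iff.1 (h3 (h', true) ⟨k.1, by simp [BipMultigraph.src, k.2]⟩)).1
  · obtain ⟨⟨n, _ | _⟩, ⟨h1, h2⟩, h3⟩ := hT.1 (Sum.inr w) (by simp)
    · obtain rfl : P.extDouble.white n = w := by simpa [BipMultigraph.src] using h2
      -- The exit `n` has a mate in the tree. Since `n` is the only exit from this white vertex, the
      -- mate is oriented towards it, and a second incoming half-edge would complete a triangle of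
      -- mates.
      obtain ⟨h, hh, hu⟩ := hrule.exists_mate (Or.inr h1)
      have hw := P.white_of_mem_mates hh
      refine ⟨h, ⟨hu.resolve_right fun k => P.ne_of_mem_mates hh ?_, hw⟩, fun h' k => ?_⟩
      · exact (Prod.ext_iff.1 (h3 (h, false) ⟨k, by simp [BipMultigraph.src, hw]⟩)).1
      · by_contra hne
        have hn : h' ≠ n := by
          rintro rfl
          exact hT.not_both k.1 h1
        have k1 := hrule.mem_mates (Or.inr h1) (Or.inl k.1) hn k.2
        exact P.notMem_mates_of_mem_mates hh k1
          (hrule.mem_mates hu (Or.inl k.1) hne (k.2.trans hw.symm))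
    · simp [BipMultigraph.src] at h2

/-- The constrained trees are sorted by the matchings they are compatible with. -/
lemma treeWeight_eq_sum [Finite V] (s : P.BdDart) (f : P.DoubleEdge → ℂ) :
    P.treeWeight (P.constrainedTrees s) f =
      ∑ M ∈ Finset.univ.filter fun M => P.extDouble.IsPerfectMatchingMinus (.bdry s) M,
        P.treeWeight (P.constrainedTreesCompatible s M) f := by
  have hcomp : ∀ (T : Finset (P.DoubleEdge × Bool)) M, CompatibleWith T M ↔
      (Finset.univ.filter fun h => (h, true) ∈ T) = M := by
    intro T M
    simp only [CompatibleWith, Finset.ext_iff, Finset.mem_filter, Finset.mem_univ, true_and]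
    exact forall_congr' fun h => ⟨Iff.symm, Iff.symm⟩
  rw [treeWeight, ← Finset.sum_fiberwise_of_maps_to
    (t := Finset.univ.filter fun M => P.extDouble.IsPerfectMatchingMinus (.bdry s) M)
    (g := fun T => Finset.univ.filter fun h => (h, true) ∈ T)]
  · refine Finset.sum_congr rfl fun M _ => ?_
    simp only [treeWeight, constrainedTreesCompatible, hcomp]
  · exact fun T hT => Finset.mem_filter.2 ⟨Finset.mem_univ _, P.exists_compatible_matching hT⟩

end PlanarMap

/-! ### Trigonometric identities for the weights -/

namespace IsoradialEmbedding

variable {V : Type*} {G : SimpleGraph V} {P : PlanarMap G} (I : IsoradialEmbedding P)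

/-- The ratio of the weights of trees and matchings at a white vertex. -/
def whiteFactor : P.DoubleWhite → ℂ
  | .edge e => Complex.I * Complex.exp (-Complex.I * (I.theta e.1 : ℂ))
  | .bdry b => -Complex.I * Complex.exp (-Complex.I * ((I.thetaBd b / 2 : ℝ) : ℂ))

lemma I_mul_exp_neg_I_mul (θ : ℝ) : Complex.I * Complex.exp (-Complex.I * (θ : ℂ)) =
    Complex.I * (Real.cos θ : ℂ) + (Real.sin θ : ℂ) := by
  rw [show -Complex.I * (θ : ℂ) = ((-θ : ℝ) : ℂ) * Complex.I by push_cast; ring, Complex.exp_mul_I,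
    ← Complex.ofReal_cos, ← Complex.ofReal_sin, Real.cos_neg, Real.sin_neg]
  push_cast
  linear_combination -(Complex.sin θ) * Complex.I_mul_I

/-- At an edge, the two mates always consist of one primal and one dual half-edge, and `sin θ + i
cos θ = i e^{-iθ}`. At the boundary, with `t` the angle `thetaBd b`, the three cases are `1 +
(e^{-it} - 1) = e^{-it}`, `(-i)(i) = 1`, and `e^{-it} - 1 = -2i e^{-it/2} sin (t/2)`. -/
lemma rhoStar_mul_sum_mates (h : P.DoubleEdge) :
    I.rhoStar h * ∑ h' ∈ P.mates h, I.rhoStar h' =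
      I.whiteFactor (P.extDouble.white h) * I.tau h := by
  have exp_half : ∀ θ : ℝ, Complex.exp (-Complex.I * ((θ / 2 : ℝ) : ℂ)) *
      Complex.exp (-Complex.I * ((θ / 2 : ℝ) : ℂ)) = Complex.exp (-Complex.I * (θ : ℂ)) := by
    intro θ
    rw [← Complex.exp_add]
    congr 1
    push_cast
    ring
  have exp_inv : ∀ θ : ℝ, Complex.exp (-Complex.I * ((θ / 2 : ℝ) : ℂ)) *
      Complex.exp (Complex.I * ((θ / 2 : ℝ) : ℂ)) = 1 := by
    intro θ
    rw [← Complex.exp_add, neg_mul, neg_add_cancel, Complex.exp_zero]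
  cases h with
  | primalHalf d =>
    rw [PlanarMap.mates, Finset.sum_pair (by simp)]
    simp only [rhoStar, tau, PlanarMap.extDouble, whiteFactor, SimpleGraph.Dart.edge_symm,
      I_mul_exp_neg_I_mul]
    ring
  | dualHalf d =>
    rw [PlanarMap.mates, Finset.sum_pair (by simp)]
    simp only [rhoStar, tau, PlanarMap.extDouble, whiteFactor, SimpleGraph.Dart.edge_symm,
      I_mul_exp_neg_I_mul]
    ring
  | bdFirst b =>
    rw [PlanarMap.mates, Finset.sum_pair (by simp)]
    simp only [rhoStar, tau, PlanarMap.extDouble, whiteFactor]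
    rw [← exp_half]
    linear_combination Complex.exp (-Complex.I * ((I.thetaBd b / 2 : ℝ) : ℂ)) *
      Complex.exp (-Complex.I * ((I.thetaBd b / 2 : ℝ) : ℂ)) * Complex.I_mul_I
  | bdSecond b =>
    rw [PlanarMap.mates, Finset.sum_singleton]
    simp only [rhoStar, tau, PlanarMap.extDouble, whiteFactor]
    linear_combination Complex.I * Complex.I * exp_inv (I.thetaBd b) + Complex.I_mul_I
  | bdPrimal b =>
    rw [PlanarMap.mates, Finset.sum_singleton]
    simp only [rhoStar, tau, PlanarMap.extDouble, whiteFactor]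
    have hsin : ∀ t : ℝ, (Real.sin t : ℂ) = (Complex.exp (-Complex.I * (t : ℂ)) -
        Complex.exp (Complex.I * (t : ℂ))) * Complex.I / 2 := by
      intro t
      rw [Complex.ofReal_sin, Complex.sin]
      ring_nf
    rw [← exp_half, hsin]
    linear_combination exp_inv (I.thetaBd b) +
      Complex.exp (-Complex.I * ((I.thetaBd b / 2 : ℝ) : ℂ)) *
      (Complex.exp (-Complex.I * ((I.thetaBd b / 2 : ℝ) : ℂ)) -
        Complex.exp (Complex.I * ((I.thetaBd b / 2 : ℝ) : ℂ))) * Complex.I_mul_I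

attribute [local instance] PlanarMap.finite_dart

lemma treeWeight_compatible_eq [Finite V] (hconn : G.Connected) {s : P.BdDart}
    {M : Finset P.DoubleEdge} (hM : P.extDouble.IsPerfectMatchingMinus (.bdry s) M) :
    P.treeWeight (P.constrainedTreesCompatible s M) I.rhoStar =
      (∏ w, I.whiteFactor w) * ∏ h ∈ M, I.tau h := by
  obtain ⟨m, hm, hmw, hmM⟩ := hM.exists_whiteEdge
  rw [P.treeWeight_compatible hconn hM]
  simp only [I.rhoStar_mul_sum_mates]
  rw [Finset.prod_mul_distrib,
    ← P.extDouble.prod_whiteEdge hm hmw hmM fun h => I.whiteFactor (P.extDouble.white h)]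
  simp only [hmw]

lemma treeWeight_constrainedTrees_eq [Finite V] (hconn : G.Connected) (s : P.BdDart) :
    P.treeWeight (P.constrainedTrees s) I.rhoStar =
      (∏ w, I.whiteFactor w) * P.extDouble.dimerZMinus (.bdry s) I.tau := by
  rw [P.treeWeight_eq_sum, BipMultigraph.dimerZMinus, Finset.mul_sum]
  exact Finset.sum_congr rfl fun M hM =>
    I.treeWeight_compatible_eq hconn (Finset.mem_filter.1 hM).2

lemma prod_whiteFactor [Finite V] [Fintype G.edgeSet] : ∏ w, I.whiteFactor w =
    (∏ e : G.edgeSet, Complex.I * Complex.exp (-Complex.I * (I.theta e.1 : ℂ))) *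
      ∏ b : P.BdDart, -Complex.I * Complex.exp (-Complex.I * ((I.thetaBd b / 2 : ℝ) : ℂ)) := by
  rw [← Equiv.prod_comp P.doubleWhiteEquiv, Fintype.prod_sum_type]
  rfl

end IsoradialEmbedding

end

theorem proposition6p6 {V : Type*} [Fintype V] [DecidableEq V] (G : SimpleGraph V)
    [DecidableRel G.Adj] (hconn : G.Connected) (hdeg : ∀ v, 2 ≤ G.degree v)
    (P : PlanarMap G) (I : IsoradialEmbedding P) (s : P.BdDart) :
    (∀ M : Finset P.DoubleEdge, P.extDouble.IsPerfectMatchingMinus (.bdry s) M →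
      P.treeWeight (P.constrainedTreesCompatible s M) I.rhoStar =
        (∏ e : G.edgeSet, Complex.I * Complex.exp (-Complex.I * (I.theta e.1 : ℂ))) *
        (∏ b : P.BdDart, -Complex.I * Complex.exp (-Complex.I * ((I.thetaBd b / 2 : ℝ) : ℂ))) *
        ∏ h ∈ M, I.tau h) ∧
    P.treeWeight (P.constrainedTrees s) I.rhoStar =
      (∏ e : G.edgeSet, Complex.I * Complex.exp (-Complex.I * (I.theta e.1 : ℂ))) *
      (∏ b : P.BdDart, -Complex.I * Complex.exp (-Complex.I * ((I.thetaBd b / 2 : ℝ) : ℂ))) *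
      P.extDouble.dimerZMinus (.bdry s) I.tau := by
  rw [← I.prod_whiteFactor]
  exact ⟨fun M hM => I.treeWeight_compatible_eq hconn hM,
    I.treeWeight_constrainedTrees_eq hconn s⟩
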